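/- Let $T>0$. For $v\in L^2(0,T)$ and $k\ge 0$ put $\omega_k=\left(\frac{\pi}{2}+k\pi\right)\frac1T$ and $v_k=\frac{2}{T}\int_0^T v(t)\sin(\omega_k t)\,dt$. The modified Hilbert transformation $\mathcal H_T\colon L^2(0,T)\to L^2(0,T)$ is given by $$(\mathcal H_T v)(t)=\sum_{k=0}^\infty v_k\cos(\omega_k t),$$ where the series converges in $L^2(0,T)$; the value $(\mathcal H_Tv)(t)$ at a single point $t$ is the limit of the partial sums of this series at $t$, whenever that limit exists. Let $$\mathcal K(s,t)=-\frac1\pi\ln\left[\tan\frac{\pi(s+t)}{4T}\,\tan\frac{\pi|t-s|}{4T}\right]$$ for $s,t\in[0,T]$, $s\neq t$. Let $a,b\in[0,T]$ with $a<b$, let $f\in H^1(a,b)\subset C[a,b]$ be real-valued, with weak derivative $\partial_t f\in L^2(a,b)$, where $f$ denotes the continuous representative. Let $v_f(s)=f(s)$ for $s\in[a,b]$ and $v_f(s)=0$ otherwise. Then $v_f\in L^2(0,T)$, and for every $t\in(0,T)\setminus\{a,b\}$ the function $s\mapsto \partial_tf(s)\,\mathcal K(s,t)$ is integrable on $(a,b)$,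 the series defining $(\mathcal H_Tv_f)(t)$ converges, and $$(\mathcal H_Tv_f)(t)=-f(b)\,\mathcal K(b,t)+f(a)\,\mathcal K(a,t)+\int_a^b\partial_tf(s)\,\mathcal K(s,t)\,ds .$$ In particular, the element $\mathcal H_Tv_f$ of $L^2(0,T)$ is given by this formula for almost every $t\in(0,T)$. If, in addition, $f(a)=0$, then the corresponding statement holds at $t=a$: $\partial_tf\,\mathcal K(\cdot,a)$ is integrable on $(a,b)$, the series converges at $a$, and $$(\mathcal H_Tv_f)(a)=-f(b)\,\mathcal K(b,a)+\int_a^b\partial_tf(s)\,\mathcal K(s,a)\,ds .$$ If $f(b)=0$, then likewise at $t=b$: $\partial_tf\,\mathcal K(\cdot,b)$ is integrable on $(a,b)$, the series converges at $b$, and $$(\mathcal H_Tv_f)(b)=f(a)\,\mathcal K(a,b)+\int_a^b\partial_tf(s)\,\mathcal K(s,b)\,ds .$$ -/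

import Mathlib

open MeasureTheory Set Filter Topology
open scoped ContDiff

noncomputable section

namespace ModHilbert

/-- Lebesgue measure on the open interval `(a, b)`. -/
abbrev intervalMeasure (a b : ℝ) : Measure ℝ := volume.restrict (Ioo a b)

/-- The real space `L²(0, T)`. -/
abbrev L2 (T : ℝ) : Type := Lp ℝ 2 (intervalMeasure 0 T)

/-- `g` is a weak derivative of `f` on `(a, b)`: integration by parts holds against every
smooth function whose support is a compact subset of `(a, b)`. -/
def HasWeakDeriv (a b : ℝ) (f g : ℝ → ℝ) : Prop :=
  ∀ φ : ℝ → ℝ, ContDiff ℝ ∞ φ → HasCompactSupport φ → tsupport φ ⊆ Ioo a b →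
    ∫ x in Ioo a b, f x * deriv φ x = -∫ x in Ioo a b, g x * φ x

/-- `f ∈ H¹(a, b)` with weak derivative `f'`. As usual in one dimension, `f` is taken to be the
representative that is continuous on `[a, b]`, so that `f a` and `f b` are the boundary values. -/
structure MemH1 (a b : ℝ) (f f' : ℝ → ℝ) : Prop where
  memLp : MemLp f 2 (intervalMeasure a b)
  memLp_deriv : MemLp f' 2 (intervalMeasure a b)
  hasWeakDeriv : HasWeakDeriv a b f f'
  continuousOn : ContinuousOn f (Icc a b)

/-- The function that is `f` on `[a, b]` and `0` elsewhere. -/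
def zeroExt (a b : ℝ) (f : ℝ → ℝ) : ℝ → ℝ := (Icc a b).indicator f

/-- The frequencies `(π/2 + kπ)/T`. -/
def freq (T : ℝ) (k : ℕ) : ℝ := (Real.pi / 2 + k * Real.pi) / T

/-- The sine coefficients `v_k = (2/T) ∫₀ᵀ v(t) sin((π/2 + kπ) t/T) dt`. -/
def sineCoeff (T : ℝ) (v : ℝ → ℝ) (k : ℕ) : ℝ :=
  2 / T * ∫ t in Ioo 0 T, v t * Real.sin (freq T k * t)

theorem memLp_cos (T w : ℝ) : MemLp (fun t => Real.cos (w * t)) 2 (intervalMeasure 0 T) :=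
  MemLp.of_bound (by fun_prop) 1 (Eventually.of_forall fun t => by
    simpa using Real.abs_cos_le_one (w * t))

theorem memLp_sin (T w : ℝ) : MemLp (fun t => Real.sin (w * t)) 2 (intervalMeasure 0 T) :=
  MemLp.of_bound (by fun_prop) 1 (Eventually.of_forall fun t => by
    simpa using Real.abs_sin_le_one (w * t))

/-- The function `t ↦ cos((π/2 + kπ) t/T)` as an element of `L²(0, T)`. -/
def cosL2 (T : ℝ) (k : ℕ) : L2 T := (memLp_cos T (freq T k)).toLp _

/-- The modified Hilbert transformation `H_T : L²(0, T) → L²(0, T)`, which maps `v` to the sum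
in `L²(0, T)` of the series `∑ v_k cos((π/2 + kπ) t/T)`. The series converges in `L²(0, T)`
for every `v`, see `hasSum_modHilbert`. -/
def modHilbert (T : ℝ) (v : L2 T) : L2 T := ∑' k : ℕ, sineCoeff T v k • cosL2 T k

/-- The value of `H_T v` at the point `t` is `y`: the series `∑ v_k cos((π/2 + kπ) t/T)`
which defines `H_T v` converges at `t`, with sum `y`. -/
def HasModHilbertValueAt (T : ℝ) (v : ℝ → ℝ) (t y : ℝ) : Prop :=
  Tendsto (fun N : ℕ => ∑ k ∈ Finset.range N, sineCoeff T v k * Real.cos (freq T k * t))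
    atTop (𝓝 y)

/-- The kernel `𝒦(s, t) = -(1/π) ln [tan(π(s+t)/(4T)) tan(π|t-s|/(4T))]`. -/
def logTanKernel (T s t : ℝ) : ℝ :=
  -(1 / Real.pi) *
    Real.log (Real.tan (Real.pi * (s + t) / (4 * T)) * Real.tan (Real.pi * |t - s| / (4 * T)))

theorem integral_cos_int {T : ℝ} (hT : 0 < T) (m : ℤ) (hm : m ≠ 0) :
    ∫ t in Ioo 0 T, Real.cos (m * Real.pi / T * t) = 0 := by
  have hc : (m * Real.pi / T : ℝ) ≠ 0 := by
    have : (m : ℝ) ≠ 0 := by exact_mod_cast hm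
    have := Real.pi_ne_zero
    positivity
  rw [← integral_Ioc_eq_integral_Ioo, ← intervalIntegral.integral_of_le hT.le,
    intervalIntegral.integral_comp_mul_left (fun x => Real.cos x) hc, integral_cos]
  have : (m * Real.pi / T * T : ℝ) = m * Real.pi := by field_simp
  rw [this, Real.sin_int_mul_pi]
  simp

theorem freq_sub (T : ℝ) (j k : ℕ) :
    freq T j - freq T k = ((j - k : ℤ) : ℝ) * Real.pi / T := by
  simp only [freq]; push_cast; ring

theorem freq_add (T : ℝ) (j k : ℕ) :
    freq T j + freq T k = ((j + k + 1 : ℤ) : ℝ) * Real.pi / T := by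
  simp only [freq]; push_cast; ring

theorem integrable_cos (T w : ℝ) : Integrable (fun t => Real.cos (w * t)) (intervalMeasure 0 T) :=
  (memLp_cos T w).integrable (by norm_num)

theorem integral_cos_freq_sub {T : ℝ} (hT : 0 < T) (j k : ℕ) :
    ∫ t in Ioo 0 T, Real.cos ((freq T j - freq T k) * t) = if j = k then T else 0 := by
  split_ifs with h
  · subst h; simp [hT.le]
  · rw [freq_sub]; exact integral_cos_int hT _ (by omega)

theorem integral_cos_freq_add {T : ℝ} (hT : 0 < T) (j k : ℕ) :
    ∫ t in Ioo 0 T, Real.cos ((freq T j + freq T k) * t) = 0 := by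
  rw [freq_add]; exact integral_cos_int hT _ (by omega)

theorem integral_sin_mul_sin {T : ℝ} (hT : 0 < T) (j k : ℕ) :
    ∫ t in Ioo 0 T, Real.sin (freq T j * t) * Real.sin (freq T k * t) =
      if j = k then T / 2 else 0 := by
  have h : ∀ t, Real.sin (freq T j * t) * Real.sin (freq T k * t) =
      (Real.cos ((freq T j - freq T k) * t) - Real.cos ((freq T j + freq T k) * t)) / 2 := by
    intro t; rw [sub_mul, add_mul, Real.cos_sub, Real.cos_add]; ring
  simp only [h]
  rw [integral_div, integral_sub (integrable_cos T _) (integrable_cos T _),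
    integral_cos_freq_sub hT, integral_cos_freq_add hT]
  split_ifs <;> simp

theorem integral_cos_mul_cos {T : ℝ} (hT : 0 < T) (j k : ℕ) :
    ∫ t in Ioo 0 T, Real.cos (freq T j * t) * Real.cos (freq T k * t) =
      if j = k then T / 2 else 0 := by
  have h : ∀ t, Real.cos (freq T j * t) * Real.cos (freq T k * t) =
      (Real.cos ((freq T j - freq T k) * t) + Real.cos ((freq T j + freq T k) * t)) / 2 := by
    intro t; rw [sub_mul, add_mul, Real.cos_sub, Real.cos_add]; ring
  simp only [h]
  rw [integral_div, integral_add (integrable_cos T _) (integrable_cos T _),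
    integral_cos_freq_sub hT, integral_cos_freq_add hT]
  split_ifs <;> simp

theorem orthonormal_toLp {T : ℝ} (hT : 0 < T) (u : ℕ → ℝ → ℝ)
    (hu : ∀ k, MemLp (u k) 2 (intervalMeasure 0 T))
    (h : ∀ j k, ∫ t in Ioo 0 T, u j t * u k t = if j = k then T / 2 else 0) :
    Orthonormal ℝ (fun k => √(2 / T) • (hu k).toLp (u k)) := by
  classical
  rw [orthonormal_iff_ite]
  intro j k
  have h1 : inner ℝ ((hu j).toLp (u j)) ((hu k).toLp (u k)) = if j = k then T / 2 else 0 := by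
    rw [L2.inner_def, ← h j k]
    refine integral_congr_ae ?_
    filter_upwards [(hu j).coeFn_toLp, (hu k).coeFn_toLp] with t hj hk
    rw [hj, hk]
    simp [mul_comm]
  have h2 : √(2 / T) * √(2 / T) = 2 / T := Real.mul_self_sqrt (by positivity)
  rw [real_inner_smul_left, real_inner_smul_right, h1, ← mul_assoc, h2]
  split_ifs
  · field_simp
  · simp

/-- The series that defines `H_T v` converges in `L²(0, T)`. -/
theorem hasSum_modHilbert {T : ℝ} (hT : 0 < T) (v : L2 T) :
    HasSum (fun k : ℕ => sineCoeff T v k • cosL2 T k) (modHilbert T v) := by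
  refine Summable.hasSum ?_
  have hs := orthonormal_toLp hT _ (fun k => memLp_sin T (freq T k)) (integral_sin_mul_sin hT)
  have hc := orthonormal_toLp hT _ (fun k => memLp_cos T (freq T k)) (integral_cos_mul_cos hT)
  have h2 : √(2 / T) * √(2 / T) = 2 / T := Real.mul_self_sqrt (by positivity)
  have key := (hc.orthogonalFamily.summable_iff_norm_sq_summable
    (fun k => inner ℝ (√(2 / T) • (memLp_sin T (freq T k)).toLp _) v)).2
    (hs.inner_products_summable v)
  refine key.congr fun k => ?_
  have h3 : inner ℝ ((memLp_sin T (freq T k)).toLp _) v =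
      ∫ t in Ioo 0 T, v t * Real.sin (freq T k * t) := by
    rw [L2.inner_def]
    refine integral_congr_ae ?_
    filter_upwards [(memLp_sin T (freq T k)).coeFn_toLp] with t ht
    rw [ht]
    simp
  rw [LinearIsometry.toSpanSingleton_apply, real_inner_smul_left, h3, smul_smul, sineCoeff,
    mul_right_comm, h2, cosL2]

end ModHilbert

end

/-!
For `f ∈ H¹(a, b)`, integration by parts turns the sine coefficients of the zero extension of `f`
into boundary terms plus cosine integrals of `f'`. Multiplying by `cos (freq T k * t)` and summing,
each of the three contributions contains the partial sums of the cosine series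
`∑ 2 / (T * freq T k) * cos (freq T k * s) * cos (freq T k * t)`, and the formula says that this
series represents the kernel `logTanKernel T s t`.

It does so in two senses. For `s ≠ t` in `[0, T]` it converges pointwise
(`tendsto_sum_kernelCoeff`): by the product formula for cosines it splits into two series
`∑ cos ((2k+1) y) / (2k+1) = -(1/2) log tan (y/2)`, which are handled in `tendsto_sum_cos_odd` by
Dirichlet's test and Abel's limit theorem. For fixed `t` it also converges in `L²(0, T)` as a
function of `s`, because its coefficients are square summable and the cosines are orthogonal; the
`L²` limit is `logTanKernel T · t` since a subsequence converges to it almost everywhere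
(`exists_hasSum_logTanKernel`). Thus the kernel is square integrable without any estimate of the
logarithmic singularity, and the series may be paired with `f' ∈ L²`
(`hasSum_integral_mul_logTanKernel`), whereas the boundary terms need only the pointwise statement.

The integration by parts (`MemH1.integral_mul_deriv`) rests on the lemma of du Bois-Reymond, by
which `f` is, up to a constant, the primitive of its weak derivative. The almost everywhere formula
for the element `modHilbert T v` of `L²(0, T)` follows from the pointwise one, because an `L²` limit
and an almost everywhere pointwise limit of the same partial sums agree.
-/

namespace ModHilbert

/-! ### The Fourier series of the logarithm of the tangent -/

theorem two_mul_sin_mul_sum_cos_odd (y : ℝ) (N : ℕ) :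
    2 * Real.sin y * ∑ k ∈ Finset.range N, Real.cos ((2 * k + 1) * y) = Real.sin (2 * N * y) := by
  induction N with
  | zero => simp
  | succ n ih =>
    rw [Finset.sum_range_succ, mul_add, ih]
    have h1 : 2 * ((n + 1 : ℕ) : ℝ) * y = (2 * n + 1) * y + y := by push_cast; ring
    have h2 : 2 * (n : ℝ) * y = (2 * n + 1) * y - y := by ring
    rw [h1, h2, Real.sin_sub, Real.sin_add]
    ring

theorem exists_tendsto_sum_cos_odd {y : ℝ} (h0 : 0 < y) (hπ : y < Real.pi) :
    ∃ l, Tendsto (fun N : ℕ => ∑ k ∈ Finset.range N, Real.cos ((2 * k + 1) * y) / (2 * k + 1))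
      atTop (𝓝 l) := by
  have hs : 0 < Real.sin y := Real.sin_pos_of_pos_of_lt_pi h0 hπ
  have hanti : Antitone (fun k : ℕ => (1 : ℝ) / (2 * k + 1)) := by
    intro j k hjk
    have : (j : ℝ) ≤ k := by exact_mod_cast hjk
    dsimp only
    gcongr
  have hlim : Tendsto (fun k : ℕ => (1 : ℝ) / (2 * k + 1)) atTop (𝓝 0) := by
    refine squeeze_zero (fun k => by positivity) (fun k => ?_)
      tendsto_one_div_add_atTop_nhds_zero_nat
    gcongr
    linarith [(Nat.cast_nonneg k : (0 : ℝ) ≤ k)]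
  have hb : ∀ n : ℕ, ‖∑ k ∈ Finset.range n, Real.cos ((2 * k + 1) * y)‖ ≤
      1 / (2 * Real.sin y) := by
    intro n
    rw [le_div_iff₀ (by positivity), Real.norm_eq_abs,
      ← abs_of_pos (show 0 < 2 * Real.sin y by positivity), ← abs_mul, mul_comm,
      two_mul_sin_mul_sum_cos_odd]
    exact Real.abs_sin_le_one _
  obtain ⟨l, hl⟩ := cauchySeq_tendsto_of_complete
    (hanti.cauchySeq_series_mul_of_tendsto_zero_of_bounded hlim hb)
  refine ⟨l, hl.congr fun N => Finset.sum_congr rfl fun k _ => ?_⟩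
  rw [smul_eq_mul]
  ring

/-- The real part of `artanh z = ∑ z ^ (2k+1) / (2k+1)` at `z = r e^{iy}`. -/
theorem hasSum_pow_mul_cos_odd {r : ℝ} (h0 : 0 ≤ r) (h1 : r < 1) (y : ℝ) :
    HasSum (fun k : ℕ => r * (Real.cos ((2 * k + 1) * y) / (2 * k + 1) * (r ^ 2) ^ k))
      (1 / 2 * (Real.log ‖1 + r * Complex.exp (Complex.I * y)‖ -
        Real.log ‖1 - r * Complex.exp (Complex.I * y)‖)) := by
  set z : ℂ := r * Complex.exp (Complex.I * y) with hz
  have hnorm : ‖z‖ < 1 := by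
    rw [hz, norm_mul, mul_comm Complex.I, Complex.norm_exp_ofReal_mul_I]
    simpa [abs_of_nonneg h0] using h1
  have hp := Complex.hasSum_taylorSeries_neg_log hnorm
  have hm := Complex.hasSum_taylorSeries_neg_log (z := -z) (by rwa [norm_neg])
  have hinj : Function.Injective fun k : ℕ => 2 * k + 1 := fun a b h => by
    simpa using h
  -- The even powers cancel in `-log (1 - z) + log (1 + z)`.
  have hodd := (hinj.hasSum_iff (f := fun n : ℕ => z ^ n / n - (-z) ^ n / n) (fun n hn => by
    have : Even n := by
      by_contra h
      obtain ⟨m, rfl⟩ := Nat.not_even_iff_odd.1 h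
      exact hn ⟨m, rfl⟩
    simp [this.neg_pow])).2 (hp.sub hm)
  have hre := (Complex.hasSum_re hodd).mul_left (1 / 2)
  simp only [sub_neg_eq_add, Complex.add_re, Complex.neg_re, Complex.log_re] at hre
  rw [← neg_add_eq_sub]
  refine (congrArg (HasSum · _) (funext fun k => ?_)).mpr hre
  have hzk : z ^ (2 * k + 1) = ((r ^ (2 * k + 1) : ℝ) : ℂ) *
      Complex.exp (((2 * k + 1) * y : ℝ) * Complex.I) := by
    rw [hz, mul_pow, ← Complex.exp_nat_mul]
    push_cast
    ring_nf
  have hcos : (z ^ (2 * k + 1)).re = r ^ (2 * k + 1) * Real.cos ((2 * k + 1) * y) := by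
    rw [hzk, Complex.re_ofReal_mul, Complex.exp_ofReal_mul_I_re]
  have hdiv : (z ^ (2 * k + 1) / ((2 * k + 1 : ℕ) : ℂ)).re =
      r ^ (2 * k + 1) * Real.cos ((2 * k + 1) * y) / (2 * k + 1) := by
    rw [Complex.div_natCast_re, hcos]
    push_cast
    rfl
  simp only [Function.comp_apply, Odd.neg_pow (odd_two_mul_add_one k), neg_div, Complex.neg_re,
    Complex.sub_re, hdiv]
  ring

/-- The Fourier series of `log tan`. Convergence is Dirichlet's test; the sum is then found by
Abel's limit theorem from the real part of `artanh` inside the unit disc. -/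
theorem tendsto_sum_cos_odd {y : ℝ} (h0 : 0 < y) (hπ : y < Real.pi) :
    Tendsto (fun N : ℕ => ∑ k ∈ Finset.range N, Real.cos ((2 * k + 1) * y) / (2 * k + 1))
      atTop (𝓝 (-(1 / 2) * Real.log (Real.tan (y / 2)))) := by
  obtain ⟨l, hl⟩ := exists_tendsto_sum_cos_odd h0 hπ
  have hs : 0 < Real.sin (y / 2) := Real.sin_pos_of_pos_of_lt_pi (by linarith) (by linarith)
  have hc : 0 < Real.cos (y / 2) := Real.cos_pos_of_mem_Ioo ⟨by linarith, by linarith⟩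
  have hminus : ‖1 - Complex.exp (Complex.I * y)‖ = 2 * Real.sin (y / 2) := by
    rw [norm_sub_rev, Complex.norm_exp_I_mul_ofReal_sub_one, Real.norm_of_nonneg (by positivity)]
  have hplus : ‖1 + Complex.exp (Complex.I * y)‖ = 2 * Real.cos (y / 2) := by
    have h := Complex.norm_exp_I_mul_ofReal_sub_one (y + Real.pi)
    rw [add_div, Real.sin_add_pi_div_two, Real.norm_of_nonneg (by positivity)] at h
    rw [← h, Complex.ofReal_add, mul_add, Complex.exp_add, mul_comm Complex.I (Real.pi : ℂ),
      Complex.exp_pi_mul_I, ← norm_neg]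
    congr 1
    ring
  have hsq : Tendsto (fun r : ℝ => r ^ 2) (𝓝[Ioo 0 1] 1) (𝓝[<] 1) := by
    refine tendsto_nhdsWithin_iff.2 ⟨?_, ?_⟩
    · have : Tendsto (fun r : ℝ => r ^ 2) (𝓝 1) (𝓝 (1 ^ 2)) := (continuous_pow 2).tendsto 1
      rw [one_pow] at this
      exact this.mono_left nhdsWithin_le_nhds
    · filter_upwards [self_mem_nhdsWithin] with r hr
      exact pow_lt_one₀ hr.1.le hr.2 two_ne_zero
  have hid : Tendsto (fun r : ℝ => r) (𝓝[Ioo 0 1] 1) (𝓝 1) :=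
    tendsto_id.mono_left nhdsWithin_le_nhds
  -- Abel's theorem is applied at `r ^ 2`: the odd powers are `r ^ (2k+1) = r * (r ^ 2) ^ k`.
  have hA := hid.mul ((Real.tendsto_tsum_powerSeries_nhdsWithin_lt hl).comp hsq)
  rw [one_mul] at hA
  have hC : ContinuousAt (fun r : ℝ => 1 / 2 *
      (Real.log ‖1 + r * Complex.exp (Complex.I * y)‖ -
        Real.log ‖1 - r * Complex.exp (Complex.I * y)‖)) 1 := by
    refine continuousAt_const.mul (ContinuousAt.sub ?_ ?_)
    · refine ContinuousAt.log (by fun_prop) ?_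
      rw [Complex.ofReal_one, one_mul, hplus]
      positivity
    · refine ContinuousAt.log (by fun_prop) ?_
      rw [Complex.ofReal_one, one_mul, hminus]
      positivity
  have hB := hC.tendsto.mono_left (nhdsWithin_le_nhds (s := Ioo 0 1))
  have : (𝓝[Ioo (0 : ℝ) 1] 1).NeBot := right_nhdsWithin_Ioo_neBot zero_lt_one
  have hl' := tendsto_nhds_unique (hA.congr' (by
    filter_upwards [self_mem_nhdsWithin] with r hr
    rw [Function.comp_apply, ← tsum_mul_left]
    exact (hasSum_pow_mul_cos_odd hr.1.le hr.2 y).tsum_eq)) hB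
  convert hl using 2
  rw [hl', Complex.ofReal_one, one_mul, hplus, hminus, Real.tan_eq_sin_div_cos,
    Real.log_div hs.ne' hc.ne', Real.log_mul two_ne_zero hs.ne', Real.log_mul two_ne_zero hc.ne']
  ring

/-! ### The cosine series of the kernel -/

/-- The Fourier coefficients of the kernel `𝒦(·, t)` with respect to `cos (freq T k * ·)`. -/
noncomputable def kernelCoeff (T t : ℝ) (k : ℕ) : ℝ :=
  2 / (T * freq T k) * Real.cos (freq T k * t)

theorem freq_pos {T : ℝ} (hT : 0 < T) (k : ℕ) : 0 < freq T k := by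
  have := Real.pi_pos
  unfold freq
  positivity

theorem tendsto_sum_kernelCoeff {T s t : ℝ} (hT : 0 < T) (hs : s ∈ Icc 0 T) (ht : t ∈ Icc 0 T)
    (hst : s ≠ t) :
    Tendsto (fun N : ℕ => ∑ k ∈ Finset.range N, kernelCoeff T t k * Real.cos (freq T k * s))
      atTop (𝓝 (logTanKernel T s t)) := by
  have hπ := Real.pi_pos
  have hd : 0 < |t - s| := abs_pos.2 (sub_ne_zero.2 hst.symm)
  have hdT : |t - s| ≤ T := abs_le.2 ⟨by linarith [hs.2, ht.1], by linarith [hs.1, ht.2]⟩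
  have hsum0 : 0 < s + t := by
    rcases abs_cases (t - s) with h | h <;> linarith [hs.1, ht.1]
  have hsumT : s + t < 2 * T := by
    rcases abs_cases (t - s) with h | h <;> linarith [hs.2, ht.2]
  -- Both `s + t` and `|t - s|` lie in `(0, 2 * T)`, where `tan (π x / (4 * T))` is positive.
  have key : ∀ x, 0 < x → x < 2 * T → 0 < Real.pi * x / (2 * T) ∧
      Real.pi * x / (2 * T) < Real.pi ∧ Real.pi * x / (2 * T) / 2 = Real.pi * x / (4 * T) ∧
      0 < Real.tan (Real.pi * x / (4 * T)) := by
    intro x h1 h2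
    refine ⟨by positivity, ?_, by ring, Real.tan_pos_of_pos_of_lt_pi_div_two (by positivity) ?_⟩
    · rw [div_lt_iff₀ (by positivity)]
      nlinarith
    · rw [div_lt_iff₀ (by positivity)]
      nlinarith
  obtain ⟨p1, p2, p3, p4⟩ := key _ hsum0 hsumT
  obtain ⟨m1, m2, m3, m4⟩ := key _ hd (by linarith)
  have h := ((tendsto_sum_cos_odd p1 p2).add (tendsto_sum_cos_odd m1 m2)).const_mul (2 / Real.pi)
  rw [p3, m3] at h
  convert h using 1
  · ext N
    rw [← Finset.sum_add_distrib, Finset.mul_sum]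
    refine Finset.sum_congr rfl fun k _ => ?_
    have e1 : (2 * k + 1) * (Real.pi * (s + t) / (2 * T)) = freq T k * t + freq T k * s := by
      unfold freq; ring
    have e2 : Real.cos ((2 * k + 1) * (Real.pi * |t - s| / (2 * T))) =
        Real.cos (freq T k * t - freq T k * s) := by
      have : (2 * k + 1) * (Real.pi * |t - s| / (2 * T)) = |freq T k * t - freq T k * s| := by
        rw [← mul_sub, abs_mul, abs_of_pos (freq_pos hT k)]
        unfold freq; ring
      rw [this, Real.cos_abs]
    rw [e1, e2, Real.cos_add, Real.cos_sub, kernelCoeff]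
    have e3 : T * freq T k = Real.pi * (2 * k + 1) / 2 := by
      unfold freq; field_simp; ring
    rw [e3]
    field_simp
    ring
  · rw [logTanKernel, Real.log_mul p4.ne' m4.ne']
    congr 1
    ring

/-! ### The lemma of du Bois-Reymond -/

/-- A smooth function of integral zero with compact support in `(a, b)` is the derivative of
another one. -/
theorem exists_testFunction_deriv_eq {a b : ℝ} (hab : a < b) {φ : ℝ → ℝ} (hφ : ContDiff ℝ ∞ φ)
    (hc : HasCompactSupport φ) (hs : tsupport φ ⊆ Ioo a b) (h0 : ∫ x, φ x = 0) :
    ∃ Φ : ℝ → ℝ, ContDiff ℝ ∞ Φ ∧ HasCompactSupport Φ ∧ tsupport Φ ⊆ Ioo a b ∧ deriv Φ = φ := by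
  -- An extra point `m` keeps the compact set nonempty when `φ = 0`.
  obtain ⟨m, hm⟩ := exists_between hab
  have hK : IsCompact (insert m (tsupport φ)) := IsCompact.insert hc m
  have hKsub : insert m (tsupport φ) ⊆ Ioo a b := insert_subset hm hs
  obtain ⟨c, hcK, hcl⟩ := hK.exists_isLeast (insert_nonempty _ _)
  obtain ⟨d, hdK, hdg⟩ := hK.exists_isGreatest (insert_nonempty _ _)
  have hac := (hKsub hcK).1
  have hdb := (hKsub hdK).2
  have hder : ∀ x, HasDerivAt (fun x => ∫ u in a..x, φ u) (φ x) x := fun x =>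
    intervalIntegral.integral_hasDerivAt_right (hφ.continuous.intervalIntegrable _ _)
      hφ.continuous.stronglyMeasurable.stronglyMeasurableAtFilter hφ.continuous.continuousAt
  have hd : deriv (fun x => ∫ u in a..x, φ u) = φ := funext fun x => (hder x).deriv
  have hsub : Function.support (fun x => ∫ u in a..x, φ u) ⊆ Icc c d := by
    intro x hx
    by_contra hcd
    apply hx
    rcases lt_or_ge x c with h | h
    · refine intervalIntegral.integral_zero_ae (Eventually.of_forall fun u hu => ?_)
      by_contra hne
      have h1 := hcl (mem_insert_of_mem m (subset_tsupport φ hne))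
      have h2 : u ≤ max a x := hu.2
      exact absurd (h1.trans h2) (not_le.2 (max_lt hac h))
    · have hdx : d < x := not_le.1 fun h' => hcd ⟨h, h'⟩
      dsimp only
      rw [intervalIntegral.integral_eq_integral_of_support_subset, h0]
      intro u hu
      have hu' := mem_insert_of_mem m (subset_tsupport φ hu)
      exact ⟨hac.trans_le (hcl hu'), (hdg hu').trans hdx.le⟩
  refine ⟨_, contDiff_infty_iff_deriv.2 ⟨fun x => (hder x).differentiableAt, by rwa [hd]⟩,
    HasCompactSupport.of_support_subset_isCompact isCompact_Icc hsub, ?_, hd⟩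
  exact (closure_minimal hsub isClosed_Icc).trans (Icc_subset_Ioo hac hdb)

theorem integrableOn_Ioo_mul {a b : ℝ} {h g : ℝ → ℝ} (hh : ContinuousOn h (Icc a b))
    (hg : Continuous g) : IntegrableOn (fun x => h x * g x) (Ioo a b) :=
  ((hh.mul hg.continuousOn).integrableOn_Icc).mono_set Ioo_subset_Icc_self

/-- The lemma of du Bois-Reymond: a continuous function with vanishing weak derivative is
constant. -/
theorem eq_const_of_forall_integral_mul_deriv_eq_zero {a b : ℝ} (hab : a < b) {h : ℝ → ℝ}
    (hh : ContinuousOn h (Icc a b))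
    (hw : ∀ φ : ℝ → ℝ, ContDiff ℝ ∞ φ → HasCompactSupport φ → tsupport φ ⊆ Ioo a b →
      ∫ x in Ioo a b, h x * deriv φ x = 0) :
    ∃ C, ∀ x ∈ Icc a b, h x = C := by
  let B : ContDiffBump ((a + b) / 2) :=
    ⟨(b - a) / 8, (b - a) / 4, by linarith, by linarith⟩
  let ψ : ℝ → ℝ := B.normed volume
  have hψ : ContDiff ℝ ∞ ψ := B.contDiff_normed
  have hψc : HasCompactSupport ψ := B.hasCompactSupport_normed
  have hψs : tsupport ψ ⊆ Ioo a b := by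
    rw [B.tsupport_normed_eq, Real.closedBall_eq_Icc]
    exact Icc_subset_Ioo (by change a < _ - (b - a) / 4; linarith)
      (by change _ + (b - a) / 4 < b; linarith)
  have hψ1 : ∫ x, ψ x = 1 := B.integral_normed
  set C := ∫ x in Ioo a b, h x * ψ x with hC
  refine ⟨C, ?_⟩
  have hae : ∀ᵐ x, x ∈ Ioo a b → h x - C = 0 := by
    refine isOpen_Ioo.ae_eq_zero_of_integral_contDiff_smul_eq_zero
      (((hh.mono Ioo_subset_Icc_self).sub continuousOn_const).locallyIntegrableOn
        measurableSet_Ioo) fun g hg hgc hgs => ?_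
    set I := ∫ x, g x with hI
    have hgi : Integrable g := hg.continuous.integrable_of_hasCompactSupport hgc
    have hψi : Integrable ψ := hψ.continuous.integrable_of_hasCompactSupport hψc
    -- Subtracting a multiple of `ψ` makes the integral vanish, so that there is a primitive.
    obtain ⟨Φ, hΦ, hΦc, hΦs, hΦd⟩ := exists_testFunction_deriv_eq hab
      (φ := fun x => g x - I * ψ x) (hg.sub (contDiff_const.mul hψ))
      (hgc.sub (hψc.mul_left (f := fun _ => I)))
      ((tsupport_sub g fun x => I * ψ x).trans
        (union_subset hgs ((tsupport_mul_subset_right (f := fun _ => I)).trans hψs)))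
      (by rw [integral_sub hgi (hψi.const_mul I), integral_const_mul, hψ1]; simp [hI])
    have h0 := hw Φ hΦ hΦc hΦs
    rw [hΦd] at h0
    have hgI : ∫ x in Ioo a b, g x = I :=
      setIntegral_eq_integral_of_forall_compl_eq_zero fun x hx =>
        image_eq_zero_of_notMem_tsupport fun h' => hx (hgs h')
    have hhg := integrableOn_Ioo_mul hh hg.continuous
    have hhψ := integrableOn_Ioo_mul hh hψ.continuous
    have e1 : ∀ x, h x * (g x - I * ψ x) = h x * g x - I * (h x * ψ x) := fun x => by ring
    simp only [e1] at h0
    rw [integral_sub hhg (hhψ.const_mul I), integral_const_mul, ← hC] at h0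
    rw [← setIntegral_eq_integral_of_forall_compl_eq_zero (s := Ioo a b) fun x hx => by
      rw [image_eq_zero_of_notMem_tsupport fun h' => hx (hgs h'), zero_smul]]
    have e2 : ∀ x, g x • (h x - C) = h x * g x - C * g x := fun x => by
      rw [smul_eq_mul]; ring
    simp only [e2]
    rw [integral_sub hhg (hgi.integrableOn.const_mul C), integral_const_mul, hgI]
    linarith
  refine Measure.eqOn_Icc_of_ae_eq volume hab.ne (g := fun _ => C) ?_ hh continuousOn_const
  rw [← restrict_Ioo_eq_restrict_Icc]
  refine (ae_restrict_iff' measurableSet_Ioo).2 ?_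
  filter_upwards [hae] with x hx hx'
  exact sub_eq_zero.1 (hx hx')

/-! ### Integration by parts in `H¹(a, b)` -/

/-- Integration by parts for the primitive of an integrable function, which is absolutely
continuous but differentiable only almost everywhere. -/
theorem integral_primitive_mul_deriv {a b : ℝ} {f' g : ℝ → ℝ}
    (hf' : IntervalIntegrable f' volume a b) (hg : ContDiff ℝ 1 g) :
    ∫ x in a..b, (∫ u in a..x, f' u) * deriv g x =
      (∫ u in a..b, f' u) * g b - ∫ x in a..b, f' x * g x := by
  rw [(hf'.absolutelyContinuousOnInterval_intervalIntegral
    left_mem_uIcc).integral_mul_deriv_eq_deriv_mul hg.contDiffOn.absolutelyContinuousOnInterval,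
    intervalIntegral.integral_same, zero_mul, sub_zero]
  congr 1
  refine intervalIntegral.integral_congr_ae ?_
  filter_upwards [hf'.ae_hasDerivAt_integral] with x hx hx'
  rw [(hx (uIoc_subset_uIcc hx') a left_mem_uIcc).deriv]

theorem MemH1.intervalIntegrable_deriv {a b : ℝ} {f f' : ℝ → ℝ} (hab : a < b)
    (hf : MemH1 a b f f') : IntervalIntegrable f' volume a b :=
  (intervalIntegrable_iff_integrableOn_Ioo_of_le hab.le).2
    (hf.memLp_deriv.integrable (by norm_num))

theorem continuousOn_primitive {a b : ℝ} {f' : ℝ → ℝ} (hab : a < b)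
    (hf' : IntervalIntegrable f' volume a b) :
    ContinuousOn (fun x => ∫ u in a..x, f' u) (Icc a b) := by
  have h := (hf'.absolutelyContinuousOnInterval_intervalIntegral
    (c := a) left_mem_uIcc).continuousOn
  rwa [uIcc_of_le hab.le] at h

/-- The fundamental theorem of calculus in `H¹(a, b)`. -/
theorem MemH1.eq_add_integral {a b : ℝ} {f f' : ℝ → ℝ} (hab : a < b) (hf : MemH1 a b f f')
    {x : ℝ} (hx : x ∈ Icc a b) : f x = f a + ∫ u in a..x, f' u := by
  have hf' := hf.intervalIntegrable_deriv hab
  have hF := continuousOn_primitive hab hf'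
  obtain ⟨C, hC⟩ := eq_const_of_forall_integral_mul_deriv_eq_zero hab
    (h := fun x => f x - ∫ u in a..x, f' u) (hf.continuousOn.sub hF) fun φ hφ hφc hφs => by
      have hφ1 : ContDiff ℝ 1 φ := hφ.of_le (by exact_mod_cast le_top)
      have hφ' : Continuous (deriv φ) := hφ1.continuous_deriv le_rfl
      have hb : φ b = 0 := image_eq_zero_of_notMem_tsupport fun h => lt_irrefl _ (hφs h).2
      have h1 := integral_primitive_mul_deriv hf' hφ1
      rw [hb, mul_zero, zero_sub, intervalIntegral.integral_of_le hab.le,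
        intervalIntegral.integral_of_le hab.le, integral_Ioc_eq_integral_Ioo,
        integral_Ioc_eq_integral_Ioo] at h1
      simp only [sub_mul]
      rw [integral_sub (integrableOn_Ioo_mul hf.continuousOn hφ') (integrableOn_Ioo_mul hF hφ'),
        hf.hasWeakDeriv φ hφ hφc hφs, h1, sub_self]
  have h1 := hC x hx
  have h2 := hC a (left_mem_Icc.2 hab.le)
  rw [intervalIntegral.integral_same] at h2
  linarith

/-- Integration by parts in `H¹(a, b)`, with boundary terms. -/
theorem MemH1.integral_mul_deriv {a b : ℝ} {f f' g : ℝ → ℝ} (hab : a < b) (hf : MemH1 a b f f')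
    (hg : ContDiff ℝ 1 g) :
    ∫ x in a..b, f x * deriv g x = f b * g b - f a * g a - ∫ x in a..b, f' x * g x := by
  have hf' := hf.intervalIntegrable_deriv hab
  have hg' : Continuous (deriv g) := hg.continuous_deriv le_rfl
  have hF := continuousOn_primitive hab hf'
  have h1 : ∫ x in a..b, f x * deriv g x =
      ∫ x in a..b, (f a * deriv g x + (∫ u in a..x, f' u) * deriv g x) := by
    refine intervalIntegral.integral_congr fun x hx => ?_
    rw [uIcc_of_le hab.le] at hx
    rw [hf.eq_add_integral hab hx, add_mul]
  have hgd : ∫ x in a..b, deriv g x = g b - g a :=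
    intervalIntegral.integral_deriv_eq_sub (fun x _ => hg.differentiable one_ne_zero x)
      (hg'.intervalIntegrable _ _)
  have hi : IntervalIntegrable (fun x => (∫ u in a..x, f' u) * deriv g x) volume a b :=
    (hF.mul hg'.continuousOn).intervalIntegrable_of_Icc hab.le
  rw [h1, intervalIntegral.integral_add ((hg'.intervalIntegrable _ _).const_mul _) hi,
    intervalIntegral.integral_const_mul, hgd, integral_primitive_mul_deriv hf' hg,
    hf.eq_add_integral hab (right_mem_Icc.2 hab.le)]
  ring

/-! ### Sine coefficients of the zero extension -/

theorem integral_zeroExt_mul {T a b : ℝ} (ha : 0 ≤ a) (hab : a < b) (hbT : b ≤ T) (f g : ℝ → ℝ) :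
    ∫ t in Ioo 0 T, zeroExt a b f t * g t = ∫ t in a..b, f t * g t := by
  have h : ∀ t, zeroExt a b f t * g t = (Icc a b).indicator (fun t => f t * g t) t := fun t =>
    (indicator_mul_left (Icc a b) f g).symm
  simp only [h]
  rw [← integral_Icc_eq_integral_Ioo, setIntegral_indicator measurableSet_Icc,
    inter_eq_right.2 (Icc_subset_Icc ha hbT), integral_Icc_eq_integral_Ioc,
    intervalIntegral.integral_of_le hab.le]

theorem sineCoeff_zeroExt {T a b : ℝ} (ha : 0 ≤ a) (hab : a < b) (hbT : b ≤ T) {f f' : ℝ → ℝ}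
    (hf : MemH1 a b f f') (k : ℕ) :
    sineCoeff T (zeroExt a b f) k = 2 / (T * freq T k) *
      (-f b * Real.cos (freq T k * b) + f a * Real.cos (freq T k * a) +
        ∫ s in a..b, f' s * Real.cos (freq T k * s)) := by
  have hT : 0 < T := by linarith
  have hw := freq_pos hT k
  have hd : deriv (fun s => -Real.cos (freq T k * s)) =
      fun s => freq T k * Real.sin (freq T k * s) := by
    ext s
    have h := ((Real.hasDerivAt_cos (freq T k * s)).comp s
      ((hasDerivAt_id s).const_mul (freq T k))).neg
    refine Eq.trans (HasDerivAt.deriv h) ?_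
    simp [mul_comm]
  have h := hf.integral_mul_deriv hab (g := fun s => -Real.cos (freq T k * s)) (by fun_prop)
  rw [hd] at h
  have e : ∀ s, f s * (freq T k * Real.sin (freq T k * s)) =
      freq T k * (f s * Real.sin (freq T k * s)) := fun s => by ring
  simp only [e, mul_neg, intervalIntegral.integral_neg, intervalIntegral.integral_const_mul] at h
  rw [sineCoeff, integral_zeroExt_mul ha hab hbT,
    show ∫ s in a..b, f s * Real.sin (freq T k * s) =
      (-f b * Real.cos (freq T k * b) + f a * Real.cos (freq T k * a) +
        ∫ s in a..b, f' s * Real.cos (freq T k * s)) / freq T k by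
      rw [eq_div_iff hw.ne']; linarith]
  field_simp

/-! ### Convergence of cosine series in `L²(0, T)` -/

/-- If a cosine series converges in `L²(0, T)` and also pointwise almost everywhere, then the two
sums agree. -/
theorem coeFn_ae_eq_of_hasSum_cosL2 {T : ℝ} {c : ℕ → ℝ} {G : L2 T} {u : ℝ → ℝ}
    (hG : HasSum (fun k => c k • cosL2 T k) G)
    (hu : ∀ᵐ s ∂(intervalMeasure 0 T),
      Tendsto (fun N : ℕ => ∑ k ∈ Finset.range N, c k * Real.cos (freq T k * s)) atTop (𝓝 (u s))) :
    G =ᵐ[intervalMeasure 0 T] u := by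
  obtain ⟨ns, hns, hae⟩ :=
    (tendstoInMeasure_of_tendsto_Lp hG.tendsto_sum_nat).exists_seq_tendsto_ae
  have hpartial : ∀ᵐ s ∂(intervalMeasure 0 T), ∀ N : ℕ,
      (∑ k ∈ Finset.range N, c k • cosL2 T k : L2 T) s =
        ∑ k ∈ Finset.range N, c k * Real.cos (freq T k * s) := by
    refine ae_all_iff.2 fun N => ?_
    have hterm : ∀ᵐ s ∂(intervalMeasure 0 T), ∀ k,
        (c k • cosL2 T k : L2 T) s = c k * Real.cos (freq T k * s) := by
      refine ae_all_iff.2 fun k => ?_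
      filter_upwards [Lp.coeFn_smul (c k) (cosL2 T k), (memLp_cos T (freq T k)).coeFn_toLp]
        with s h1 h2
      rw [h1, Pi.smul_apply, smul_eq_mul, cosL2, h2]
    filter_upwards [Lp.coeFn_finsetSum (Finset.range N) fun k => c k • cosL2 T k, hterm]
      with s h1 h2
    rw [h1, Finset.sum_apply]
    exact Finset.sum_congr rfl fun k _ => h2 k
  filter_upwards [hae, hpartial, hu] with s h1 h2 h3
  refine tendsto_nhds_unique h1 ?_
  simp only [h2]
  exact h3.comp hns.tendsto_atTop

theorem summable_smul_cosL2 {T : ℝ} (hT : 0 < T) {c : ℕ → ℝ} (hc : Summable fun k => c k ^ 2) :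
    Summable fun k => c k • cosL2 T k := by
  have ho := orthonormal_toLp hT _ (fun k => memLp_cos T (freq T k)) (integral_cos_mul_cos hT)
  have h2 : √(2 / T) ≠ 0 := (Real.sqrt_pos.2 (by positivity)).ne'
  have key := (ho.orthogonalFamily.summable_iff_norm_sq_summable (fun k => c k / √(2 / T))).2 (by
    simp only [norm_div, div_pow, Real.norm_eq_abs, sq_abs]
    exact hc.div_const _)
  refine key.congr fun k => ?_
  rw [LinearIsometry.toSpanSingleton_apply, smul_smul, div_mul_cancel₀ _ h2, cosL2]

theorem summable_kernelCoeff_sq {T : ℝ} (hT : 0 < T) (t : ℝ) :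
    Summable fun k => kernelCoeff T t k ^ 2 := by
  have hs : Summable fun k : ℕ => 4 * (1 / ((k + 1 : ℕ) : ℝ) ^ 2) :=
    ((summable_nat_add_iff 1).2 (Real.summable_one_div_nat_pow.2 one_lt_two)).mul_left 4
  refine Summable.of_nonneg_of_le (fun k => sq_nonneg _) (fun k => ?_) hs
  have hk : ((k + 1 : ℕ) : ℝ) ≤ T * freq T k := by
    have h : T * freq T k = Real.pi / 2 + k * Real.pi := by unfold freq; field_simp
    rw [h]
    push_cast
    nlinarith [Real.pi_gt_three, (Nat.cast_nonneg k : (0 : ℝ) ≤ k)]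
  have hb : |kernelCoeff T t k| ≤ 2 / ((k + 1 : ℕ) : ℝ) := by
    have hw := freq_pos hT k
    rw [kernelCoeff, abs_mul, abs_of_pos (by positivity)]
    calc 2 / (T * freq T k) * |Real.cos (freq T k * t)| ≤ 2 / (T * freq T k) * 1 := by
          gcongr
          exact Real.abs_cos_le_one _
      _ ≤ 2 / ((k + 1 : ℕ) : ℝ) := by rw [mul_one]; gcongr
  calc kernelCoeff T t k ^ 2 = |kernelCoeff T t k| ^ 2 := (sq_abs _).symm
    _ ≤ (2 / ((k + 1 : ℕ) : ℝ)) ^ 2 := by gcongr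
    _ = 4 * (1 / ((k + 1 : ℕ) : ℝ) ^ 2) := by ring

/-- The cosine series of the kernel `𝒦(·, t)` converges to it in `L²(0, T)`. -/
theorem exists_hasSum_logTanKernel {T t : ℝ} (hT : 0 < T) (ht : t ∈ Icc 0 T) :
    ∃ G : L2 T, HasSum (fun k => kernelCoeff T t k • cosL2 T k) G ∧
      G =ᵐ[intervalMeasure 0 T] fun s => logTanKernel T s t := by
  obtain ⟨G, hG⟩ := summable_smul_cosL2 hT (summable_kernelCoeff_sq hT t)
  refine ⟨G, hG, coeFn_ae_eq_of_hasSum_cosL2 hG ?_⟩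
  have hne : ∀ᵐ s ∂(intervalMeasure 0 T), s ≠ t := Measure.ae_ne _ t
  filter_upwards [ae_restrict_mem measurableSet_Ioo, hne] with s hs hst
  exact tendsto_sum_kernelCoeff hT (Ioo_subset_Icc_self hs) ht hst

theorem memLp_logTanKernel {T t : ℝ} (hT : 0 < T) (ht : t ∈ Icc 0 T) :
    MemLp (fun s => logTanKernel T s t) 2 (intervalMeasure 0 T) := by
  obtain ⟨G, -, hG⟩ := exists_hasSum_logTanKernel hT ht
  exact (memLp_congr_ae hG).1 (Lp.memLp G)

theorem memLp_zeroExt {T a b : ℝ} {u : ℝ → ℝ} (hu : MemLp u 2 (intervalMeasure a b)) :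
    MemLp (zeroExt a b u) 2 (intervalMeasure 0 T) := by
  rw [zeroExt, memLp_indicator_iff_restrict measurableSet_Icc,
    Measure.restrict_restrict measurableSet_Icc]
  rw [intervalMeasure, restrict_Ioo_eq_restrict_Icc] at hu
  exact hu.mono_measure (Measure.restrict_mono inter_subset_left le_rfl)

theorem intervalIntegrable_mul_logTanKernel {T a b t : ℝ} (ha : 0 ≤ a) (hab : a < b)
    (hbT : b ≤ T) {u : ℝ → ℝ} (hu : MemLp u 2 (intervalMeasure a b)) (ht : t ∈ Icc 0 T) :
    IntervalIntegrable (fun s => u s * logTanKernel T s t) volume a b :=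
  (intervalIntegrable_iff_integrableOn_Ioo_of_le hab.le).2
    (hu.integrable_mul ((memLp_logTanKernel (by linarith) ht).mono_measure
      (Measure.restrict_mono (Ioo_subset_Ioo ha hbT) le_rfl)))

/-- The cosine series of `𝒦(·, t)` may be integrated termwise against an `L²` function. -/
theorem hasSum_integral_mul_logTanKernel {T a b t : ℝ} (ha : 0 ≤ a) (hab : a < b) (hbT : b ≤ T)
    {u : ℝ → ℝ} (hu : MemLp u 2 (intervalMeasure a b)) (ht : t ∈ Icc 0 T) :
    HasSum (fun k => kernelCoeff T t k * ∫ s in a..b, u s * Real.cos (freq T k * s))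
      (∫ s in a..b, u s * logTanKernel T s t) := by
  obtain ⟨G, hG, hGae⟩ := exists_hasSum_logTanKernel (by linarith) ht
  have hz := memLp_zeroExt (T := T) hu
  have hinner : ∀ (g : ℝ → ℝ) (F : L2 T), F =ᵐ[intervalMeasure 0 T] g →
      innerSL ℝ (hz.toLp _) F = ∫ s in a..b, u s * g s := by
    intro g F hF
    rw [innerSL_apply_apply, L2.inner_def, ← integral_zeroExt_mul ha hab hbT]
    refine integral_congr_ae ?_
    filter_upwards [hz.coeFn_toLp, hF] with s h1 h2
    rw [h1, h2, real_inner_eq_re_inner, RCLike.inner_apply]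
    simp [mul_comm]
  have h := (innerSL ℝ (hz.toLp _)).hasSum hG
  rw [hinner _ _ hGae] at h
  refine (congrArg (HasSum · _) (funext fun k => ?_)).mpr h
  rw [map_smul, smul_eq_mul, cosL2,
    hinner _ _ (memLp_cos T (freq T k)).coeFn_toLp]

/-! ### The values of the modified Hilbert transform -/

/-- The formula for `H_T v_f` holds at every point of `[0, T]` where the boundary terms are finite
or multiplied by zero. -/
theorem MemH1.hasModHilbertValueAt {T a b t : ℝ} (ha : 0 ≤ a) (hab : a < b) (hbT : b ≤ T)
    {f f' : ℝ → ℝ} (hf : MemH1 a b f f') (ht : t ∈ Icc 0 T) (hta : f a = 0 ∨ a ≠ t)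
    (htb : f b = 0 ∨ b ≠ t) :
    HasModHilbertValueAt T (zeroExt a b f) t
      (-f b * logTanKernel T b t + f a * logTanKernel T a t
        + ∫ s in a..b, f' s * logTanKernel T s t) := by
  have hT : 0 < T := by linarith
  have hbd : ∀ s ∈ Icc 0 T, ∀ y : ℝ, y = 0 ∨ s ≠ t →
      Tendsto (fun N : ℕ => y * ∑ k ∈ Finset.range N, kernelCoeff T t k * Real.cos (freq T k * s))
        atTop (𝓝 (y * logTanKernel T s t)) := by
    rintro s hs y (rfl | hst)
    · simp
    · exact (tendsto_sum_kernelCoeff hT hs ht hst).const_mul y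
  have h1 := hbd b ⟨by linarith, hbT⟩ (-f b) (htb.imp_left fun h => by rw [h, neg_zero])
  have h2 := hbd a ⟨ha, by linarith⟩ (f a) hta
  have h3 := (hasSum_integral_mul_logTanKernel ha hab hbT hf.memLp_deriv ht).tendsto_sum_nat
  refine ((h1.add h2).add h3).congr fun N => ?_
  rw [Finset.mul_sum, Finset.mul_sum, ← Finset.sum_add_distrib, ← Finset.sum_add_distrib]
  refine Finset.sum_congr rfl fun k _ => ?_
  rw [sineCoeff_zeroExt ha hab hbT hf, kernelCoeff]
  ring

theorem sineCoeff_congr_ae {T : ℝ} {u v : ℝ → ℝ} (h : u =ᵐ[intervalMeasure 0 T] v) (k : ℕ) :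
    sineCoeff T u k = sineCoeff T v k := by
  rw [sineCoeff, sineCoeff]
  congr 1
  refine integral_congr_ae ?_
  filter_upwards [h] with s hs
  rw [hs]

end ModHilbert

open ModHilbert in
theorem lemma2p2 (T a b : ℝ) (ha : 0 ≤ a) (hab : a < b) (hbT : b ≤ T)
    (f f' : ℝ → ℝ) (hf : MemH1 a b f f') :
    -- the zero extension lies in `L²(0, T)`, and the formula holds for its image under `H_T`
    (∃ hv : MemLp (zeroExt a b f) 2 (intervalMeasure 0 T),
      ∀ᵐ t ∂(intervalMeasure 0 T), modHilbert T (hv.toLp (zeroExt a b f)) t =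
        -f b * logTanKernel T b t + f a * logTanKernel T a t
          + ∫ s in a..b, f' s * logTanKernel T s t) ∧
    -- the formula holds pointwise on `(0, T)` away from `a` and `b`
    (∀ t ∈ Ioo 0 T \ {a, b},
      IntervalIntegrable (fun s => f' s * logTanKernel T s t) volume a b ∧
      HasModHilbertValueAt T (zeroExt a b f) t
        (-f b * logTanKernel T b t + f a * logTanKernel T a t
          + ∫ s in a..b, f' s * logTanKernel T s t)) ∧
    -- the formula at `t = a`
    (f a = 0 →
      IntervalIntegrable (fun s => f' s * logTanKernel T s a) volume a b ∧
      HasModHilbertValueAt T (zeroExt a b f) a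
        (-f b * logTanKernel T b a + ∫ s in a..b, f' s * logTanKernel T s a)) ∧
    -- the formula at `t = b`
    (f b = 0 →
      IntervalIntegrable (fun s => f' s * logTanKernel T s b) volume a b ∧
      HasModHilbertValueAt T (zeroExt a b f) b
        (f a * logTanKernel T a b + ∫ s in a..b, f' s * logTanKernel T s b)) := by
  have hint := fun t => intervalIntegrable_mul_logTanKernel (t := t) ha hab hbT hf.memLp_deriv
  have hval : ∀ t ∈ Ioo 0 T \ {a, b}, HasModHilbertValueAt T (zeroExt a b f) t
      (-f b * logTanKernel T b t + f a * logTanKernel T a t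
        + ∫ s in a..b, f' s * logTanKernel T s t) := fun t ht =>
    hf.hasModHilbertValueAt ha hab hbT (Ioo_subset_Icc_self ht.1)
      (Or.inr fun h => ht.2 (Or.inl h.symm)) (Or.inr fun h => ht.2 (Or.inr h.symm))
  have hat : a ∈ Icc 0 T := ⟨ha, by linarith⟩
  have hbt : b ∈ Icc 0 T := ⟨by linarith, hbT⟩
  refine ⟨⟨memLp_zeroExt hf.memLp, ?_⟩, fun t ht => ⟨hint t (Ioo_subset_Icc_self ht.1), hval t ht⟩,
    fun h0 => ⟨hint a hat, ?_⟩, fun h0 => ⟨hint b hbt, ?_⟩⟩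
  · refine coeFn_ae_eq_of_hasSum_cosL2 (hasSum_modHilbert (by linarith) _) ?_
    have hnea : ∀ᵐ t ∂(intervalMeasure 0 T), t ≠ a := Measure.ae_ne _ a
    have hneb : ∀ᵐ t ∂(intervalMeasure 0 T), t ≠ b := Measure.ae_ne _ b
    filter_upwards [ae_restrict_mem measurableSet_Ioo, hnea, hneb] with t ht h1 h2
    simp only [sineCoeff_congr_ae (memLp_zeroExt hf.memLp).coeFn_toLp]
    exact hval t ⟨ht, by simp [h1, h2]⟩
  · simpa [h0] using hf.hasModHilbertValueAt ha hab hbT hat (Or.inl h0) (Or.inr hab.ne')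
  · simpa [h0] using hf.hasModHilbertValueAt ha hab hbT hbt (Or.inr hab.ne) (Or.inl h0)
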